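/- **Setting.** Let $\mathcal{X}$ be a countable domain and $\mathcal{H}\subseteq\{0,1\}^{\mathcal{X}}$ a hypothesis class. A learner $\mathcal{A}$ maps each finite labeled sequence $T$ over $\mathcal{X}\times\{0,1\}$ to a predictor $\mathcal{A}(T):\mathcal{X}\to\{0,1\}$; it is randomized if the prediction may also depend on internal randomness independent of the data. For a probability distribution $\mathcal{D}$ on $\mathcal{X}$ and $m\in\mathbb{N}$, let $$\epsilon_{\mathcal{A}}(\mathcal{D},m)=\sup_{h\in\mathcal{H}}\ \Pr\big[\mathcal{A}\big((x_1,h(x_1)),\dots,(x_m,h(x_m))\big)(x)\neq h(x)\big],$$ where $x_1,\dots,x_m,x$ are i.i.d. from $\mathcal{D}$ (and the probability is also over the internal randomness of $\mathcal{A}$). A function $\mathcal{C}$ from finite sequences over $\mathcal{X}$ to $[0,1]$ is a *sound certifier* for $\mathcal{A}$ if $\mathbb{E}_{S\sim\mathcal{D}^m}[\mathcal{C}(S)]\ge\epsilon_{\mathcal{A}}(\mathcal{D},m)$ for all probability distributions $\mathcal{D}$ on $\mathcal{X}$ and all $m\in\mathbb{N}$. A function $\epsilon$ assigning to each probability distribution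 $\mathcal{D}$ on $\mathcal{X}$ and $m\in\mathbb{N}$ a number $\epsilon(\mathcal{D},m)\in[0,1]$ is *certifiable* if for each $\mathcal{D}$ there are a deterministic learner $\mathcal{A}_{\mathcal{D}}$ and a sound certifier $\mathcal{C}_{\mathcal{D}}$ for $\mathcal{A}_{\mathcal{D}}$ with $\mathbb{E}_{S\sim\mathcal{D}^m}[\mathcal{C}_{\mathcal{D}}(S)]\le\epsilon(\mathcal{D},m)$ for all $m\in\mathbb{N}$. For $\alpha>0$ and $\sigma:\mathbb{N}\times(0,1)\to\mathbb{N}$, a learner $\mathcal{A}$ is *relatively $(\alpha,\sigma)$-smart* if $$\epsilon_{\mathcal{A}}(\mathcal{D},\sigma(m,\eta))\le\alpha\,\epsilon(\mathcal{D},m)+\eta$$ for every certifiable $\epsilon$, every probability distribution $\mathcal{D}$ on $\mathcal{X}$, every $m\in\mathbb{N}$ and every $\eta\in(0,1)$. **Theorem 4.1.** There exist a countable domain $\mathcal{X}$ and a hypothesis class $\mathcal{H}\subseteq\{0,1\}^{\mathcal{X}}$ such that for all constants $\alpha>0$ and $\beta>0$ and every function $\sigma:\mathbb{N}\times(0,1)\to\mathbb{N}$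 with $\sigma(m,\eta)=O_\eta(m^{2-\beta})$ as $m\to\infty$ (that is, for each fixed $\eta\in(0,1)$, with an implied constant that may depend on $\eta$), no learner, deterministic or randomized, is relatively $(\alpha,\sigma)$-smart. -/

import Mathlib

open MeasureTheory

namespace SmartLearning

/-- A deterministic learner: it maps every finite labeled training sequence
`(x₁, y₁), …, (xₘ, yₘ)` to a predictor `X → {0,1}`. Finite sequences of length `m` are functions
on `Fin m`; labels are Booleans. -/
def Learner (X : Type) : Type :=
  ∀ m : ℕ, (Fin m → X × Bool) → X → Bool

/-- A possibly randomized learner: given the training sequence and a test point, it returns the law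
of the predicted label. The internal randomness of a learner enters its expected 0-1 error only
through these laws. -/
def RandomizedLearner (X : Type) : Type :=
  ∀ m : ℕ, (Fin m → X × Bool) → X → PMF Bool

/-- A deterministic learner, seen as a randomized learner that uses no randomness. -/
noncomputable def Learner.toRandomized {X : Type} (A : Learner X) : RandomizedLearner X :=
  fun m T x => PMF.pure (A m T x)

/-- A certifier `X^* → [0,1]`: it maps every finite unlabeled sample to a number in `[0,1]`. -/
def Certifier (X : Type) : Type :=
  ∀ m : ℕ, (Fin m → X) → unitInterval

/-- The unlabeled sample `s`, labeled by the ground truth `h`. -/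
def labelSample {X : Type} (h : X → Bool) {m : ℕ} (s : Fin m → X) : Fin m → X × Bool :=
  fun i => (s i, h (s i))

section

/- The domain carries a σ-algebra; in the theorem it is the discrete one on a countable set, so all
functions below are measurable (and they are bounded, hence integrable). -/
variable {X : Type} [MeasurableSpace X]

/-- The law `D^m` of `m` i.i.d. unlabeled samples from `D`. -/
noncomputable def sampleLaw (D : ProbabilityMeasure X) (m : ℕ) : Measure (Fin m → X) :=
  Measure.pi fun _ : Fin m => (D : Measure X)

/-- The expected 0-1 loss of a (randomized) predictor `f` when the marginal is `D` and the ground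
truth is `h`: the expectation over `x ∼ D` of the probability that `f` predicts the wrong label
`1 - h x` at `x`. -/
noncomputable def loss (f : X → PMF Bool) (D : ProbabilityMeasure X) (h : X → Bool) : ℝ :=
  ∫ x, (f x (!(h x))).toReal ∂(D : Measure X)

/-- The expected loss of the learner `A` trained on `m` i.i.d. samples from `D` labeled by `h`. -/
noncomputable def expectedLoss (A : RandomizedLearner X) (D : ProbabilityMeasure X)
    (h : X → Bool) (m : ℕ) : ℝ :=
  ∫ s, loss (A m (labelSample h s)) D h ∂(sampleLaw D m)

/-- The distribution-dependent error rate `ε_A(D, m)` of the learner `A`: the supremum over the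
hypotheses `h ∈ H` of its expected loss. (The supremum is over a subset of `[0,1]`.) -/
noncomputable def errorRate (H : Set (X → Bool)) (A : RandomizedLearner X)
    (D : ProbabilityMeasure X) (m : ℕ) : ℝ :=
  ⨆ h : H, expectedLoss A D h m

/-- The expected output of the certifier `C` on `m` i.i.d. unlabeled samples from `D`. -/
noncomputable def expectedCertificate (C : Certifier X) (D : ProbabilityMeasure X) (m : ℕ) : ℝ :=
  ∫ s, (C m s : ℝ) ∂(sampleLaw D m)

/-- `C` is a sound certifier for the learner `A` in the distribution-free setting: for every
marginal distribution and every sample size, its expected output is at least the error of `A`. -/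
def IsSoundCertifier (H : Set (X → Bool)) (A : RandomizedLearner X) (C : Certifier X) : Prop :=
  ∀ (D : ProbabilityMeasure X) (m : ℕ), errorRate H A D m ≤ expectedCertificate C D m

/-- The distribution-dependent error rate `ε` is certifiable: for every `D` there is a learner
(which may be chosen for `D`) with a certifier that is sound for it with respect to *all*
distributions and whose expected output on samples from `D` is at most `ε D m` for every `m`.
The learners in this benchmark are deterministic. -/
def IsCertifiable (H : Set (X → Bool)) (ε : ProbabilityMeasure X → ℕ → unitInterval) : Prop :=
  ∀ D : ProbabilityMeasure X, ∃ (A : Learner X) (C : Certifier X),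
    IsSoundCertifier H A.toRandomized C ∧ ∀ m : ℕ, expectedCertificate C D m ≤ (ε D m : ℝ)

/-- The learner `A` is relatively `(α, σ)`-smart for `H` in the distribution-free setting. -/
def IsRelativelySmart (H : Set (X → Bool)) (α : ℝ) (σ : ℕ → Set.Ioo (0 : ℝ) 1 → ℕ)
    (A : RandomizedLearner X) : Prop :=
  ∀ ε : ProbabilityMeasure X → ℕ → unitInterval, IsCertifiable H ε →
    ∀ (D : ProbabilityMeasure X) (m : ℕ) (η : Set.Ioo (0 : ℝ) 1),
      errorRate H A D (σ m η) ≤ α * (ε D m : ℝ) + (η : ℝ)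

end

end SmartLearning

/-!
The gap is quadratic because a sample of size about `√n` is enough to *check* that a distribution
does not concentrate on few of `n` known points (by the birthday paradox), while about `n` samples
are needed to learn which points these are.

*The class.* In the plane over the field with `n = 2 ^ r` elements, each polynomial `g` of degree
less than `d = n / (r + 1)` has the curve of the points `(a, g(a) * (g(a) + 1))`. The second
coordinate determines the value `g(a)` up to adding `1`, and the hypothesis of `g` tells the two
possible values apart on the curve and is `false` off the curve. Two curves coincide if the
polynomials differ by a constant `0` or `1`, and otherwise meet in at most `2 * d = o(n)` points.
Thus each hypothesis agrees on the curve of `g`, up to few exceptions, with the hypothesis of `g`,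
with its negation or with `false` (`exists_exceptions`).

*Known curve.* A learner that knows `g` splits the domain into the two cells on which the hypothesis
of `g` is constant and predicts on each cell the label of the first training point in it
(`cellRule`). For every marginal, its loss is hardly more than `1 / 2`, and it is small if the
exceptional set `B` (the exceptions on the curve and the complement of the curve) has small mass.
The certificate is a small number `c` if the sample consists of distinct points of the curve, and
`1` otherwise. It is sound (`isSoundCertifier_cellRule`): if `B` has mass at least a constant
multiple of `c`, then a sample of size `m` with `m ^ 2` much larger than `d` is unlikely to consist
of distinct points of the curve (`distinctProb_le_quarter`), so that the expected certificate is at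
least `3 / 4`. On the other hand, for the uniform distribution on the curve and `m ^ 2 ≤ c * n`,
repetitions are unlikely, and the expected certificate is at most `2 * c` (`exists_certified`).

*Unknown curve.* Given fewer than `d` samples from the curve and another point with parameter `b`,
adding to `g` the Lagrange polynomial that is `1` at `b` and `0` at the sampled parameters changes
nothing in what the learner sees, but flips the label at `b` (`exists_flip`). Hence, on average over
`g`, a learner errs half of the time at new points (`exists_le_expectedLoss`).

For fixed `c`, a sample size of order `m ^ (2 - β)` is of order `n ^ (1 - β / 2)` and so below `d`
for large `n` (`eventually_lt_degreeBound`). A smart learner would have to compete with the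
certified learner for the curve on which it fails.
-/

namespace SmartLearning

/-! ### Integrals over i.i.d. samples -/

section Sample

variable {X : Type} [MeasurableSpace X] [DiscreteMeasurableSpace X] [Countable X]

instance (D : ProbabilityMeasure X) (m : ℕ) : IsProbabilityMeasure (sampleLaw D m) := by
  unfold sampleLaw; infer_instance

theorem integrable_of_abs_le_one {Y : Type*} [MeasurableSpace Y] [DiscreteMeasurableSpace Y]
    [Countable Y] (μ : Measure Y) [IsFiniteMeasure μ] {F : Y → ℝ} (hF : ∀ y, |F y| ≤ 1) :
    Integrable F μ :=
  Integrable.of_bound (Measurable.of_discrete).aestronglyMeasurable 1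
    (Filter.Eventually.of_forall fun y => by simpa using hF y)

/-- Splitting off the first sample point. -/
theorem integral_sampleLaw_succ (D : ProbabilityMeasure X) (m : ℕ) (F : (Fin (m + 1) → X) → ℝ)
    (hF : ∀ s, |F s| ≤ 1) :
    ∫ s, F s ∂(sampleLaw D (m + 1)) =
      ∫ x, ∫ s, F (Fin.cons x s) ∂(sampleLaw D m) ∂(D : Measure X) := by
  have h := (measurePreserving_piFinSuccAbove (fun _ : Fin (m + 1) => (D : Measure X)) 0).symm
  have h1 := h.integral_comp' (g := F)
  unfold sampleLaw
  rw [← h1, integral_prod]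
  · simp [MeasurableEquiv.piFinSuccAbove_symm_apply, Fin.insertNthEquiv]
  · exact integrable_of_abs_le_one _ fun y => hF _

theorem abs_integral_le_one {Y : Type*} [MeasurableSpace Y] (μ : Measure Y)
    [IsProbabilityMeasure μ] {F : Y → ℝ} (hF : ∀ y, |F y| ≤ 1) : |∫ y, F y ∂μ| ≤ 1 := by
  have := norm_integral_le_of_norm_le_const (μ := μ) (f := F) (C := 1)
    (Filter.Eventually.of_forall fun y => by simpa using hF y)
  simpa using this

end Sample

/-! ### Elementary inequalities -/

theorem abs_toReal_pmf_le_one (q : PMF Bool) (y : Bool) : |(q y).toReal| ≤ 1 := by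
  rw [abs_of_nonneg ENNReal.toReal_nonneg]
  exact ENNReal.toReal_le_of_le_ofReal zero_le_one (by simpa using PMF.coe_le_one _ _)

theorem one_sub_pow_le (p : ℝ) (h0 : 0 ≤ p) (h1 : p ≤ 1) (m : ℕ) :
    (1 - p) ^ m ≤ 1 / (1 + m * p) := by
  have h2 : 1 + (m : ℝ) * p ≤ (1 + p) ^ m := one_add_mul_le_pow (by linarith) m
  have h3 : (1 - p) ^ m * (1 + p) ^ m ≤ 1 := by
    rw [← mul_pow]; exact pow_le_one₀ (by nlinarith) (by nlinarith)
  rw [le_div_iff₀ (by positivity)]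
  exact (mul_le_mul_of_nonneg_left h2 (pow_nonneg (by linarith) m)).trans h3

theorem mul_one_sub_pow_le (p : ℝ) (h0 : 0 ≤ p) (h1 : p ≤ 1) (m : ℕ) :
    p * (1 - p) ^ m ≤ 1 / (m + 1) := by
  refine (mul_le_mul_of_nonneg_left (one_sub_pow_le p h0 h1 m) h0).trans ?_
  rw [mul_one_div, div_le_div_iff₀ (by positivity) (by positivity)]
  nlinarith

/-! ### The cell rule -/

section CellRule

/-- The prediction of the cell rule on the cell `f = c`: the label of the first training point in
this cell, and `false` if there is none. -/
def cellPredict {X : Type} (f : X → Bool) : ∀ m : ℕ, (Fin m → X × Bool) → Bool → Bool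
  | 0, _, _ => false
  | m + 1, T, c => if f (T 0).1 = c then (T 0).2 else cellPredict f m (Fin.tail T) c

/-- The cell rule for the partition of `X` into the two cells `f = false` and `f = true`. -/
def cellRule {X : Type} (f : X → Bool) : Learner X := fun m T x => cellPredict f m T (f x)

variable {X : Type} [MeasurableSpace X] [DiscreteMeasurableSpace X] [Countable X]

/-- The probability that the cell rule does not predict `y` on the cell `f = c`. -/
noncomputable def cellError (D : ProbabilityMeasure X) (f h : X → Bool) (m : ℕ) (c y : Bool) : ℝ :=
  ∫ s, (if cellPredict f m (labelSample h s) c = !y then 1 else 0) ∂(sampleLaw D m)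

/-- The probability that a point falls in the cell `f = c` and has the label `y`. -/
noncomputable def cellMass (D : ProbabilityMeasure X) (f h : X → Bool) (c y : Bool) : ℝ :=
  (D : Measure X).real {x | f x = c ∧ h x = y}

omit [Countable X] in
theorem integral_cells (D : ProbabilityMeasure X) (f h : X → Bool) (G : Bool → Bool → ℝ) :
    ∫ x, G (f x) (h x) ∂(D : Measure X) =
      cellMass D f h false false * G false false + cellMass D f h false true * G false true +
      (cellMass D f h true false * G true false + cellMass D f h true true * G true true) := by
  have h1 : ∫ x, G (f x) (h x) ∂(D : Measure X) =
      ∫ z, G z.1 z.2 ∂((D : Measure X).map fun x => (f x, h x)) := by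
    rw [integral_map Measurable.of_discrete.aemeasurable
      Measurable.of_discrete.aestronglyMeasurable]
  have : IsProbabilityMeasure ((D : Measure X).map fun x => (f x, h x)) :=
    Measure.isProbabilityMeasure_map Measurable.of_discrete.aemeasurable
  have h2 : ∀ c y, ((D : Measure X).map fun x => (f x, h x)).real {(c, y)} =
      cellMass D f h c y := by
    intro c y
    rw [map_measureReal_apply Measurable.of_discrete .of_discrete]
    unfold cellMass
    congr 1
    ext x; simp
  rw [h1, integral_fintype .of_finite]
  simp only [Fintype.sum_prod_type, Fintype.sum_bool, h2, smul_eq_mul]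
  ring

omit [Countable X] in
theorem sum_cellMass (D : ProbabilityMeasure X) (f h : X → Bool) :
    cellMass D f h false false + cellMass D f h false true +
      (cellMass D f h true false + cellMass D f h true true) = 1 := by
  have := integral_cells D f h fun _ _ => 1
  simpa using this.symm

omit [DiscreteMeasurableSpace X] [Countable X] in
theorem cellMass_nonneg (D : ProbabilityMeasure X) (f h : X → Bool) (c y : Bool) :
    0 ≤ cellMass D f h c y := measureReal_nonneg

/-- Recursion on the label of the first training point: it decides if it lies in the cell. -/
theorem cellError_succ (D : ProbabilityMeasure X) (f h : X → Bool) (m : ℕ) (c y : Bool) :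
    cellError D f h (m + 1) c y = cellMass D f h c (!y) +
      (1 - (cellMass D f h c y + cellMass D f h c (!y))) * cellError D f h m c y := by
  have hs := sum_cellMass D f h
  have key : cellError D f h (m + 1) c y =
      ∫ x, (if f x = c then (if h x = !y then 1 else 0) else cellError D f h m c y)
        ∂(D : Measure X) := by
    unfold cellError
    rw [integral_sampleLaw_succ _ _ _ (fun s => by split_ifs <;> simp)]
    congr 1
    funext x
    have hc : ∀ s : Fin m → X,
        cellPredict f (m + 1) (labelSample h (Fin.cons x s : Fin (m + 1) → X)) c =
        if f x = c then h x else cellPredict f m (labelSample h s) c := by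
      intro s; rfl
    simp only [hc]
    by_cases hx : f x = c <;> simp [hx]
  rw [key, integral_cells D f h fun a b =>
    if a = c then (if b = !y then 1 else 0) else cellError D f h m c y]
  cases c <;> cases y <;> simp <;> linear_combination (cellError D f h m _ _) * hs

theorem cellError_le (D : ProbabilityMeasure X) (f h : X → Bool) (m : ℕ) (c y : Bool)
    (hpos : 0 < cellMass D f h c y + cellMass D f h c (!y)) :
    cellError D f h m c y ≤ (1 - (cellMass D f h c y + cellMass D f h c (!y))) ^ m +
      cellMass D f h c (!y) / (cellMass D f h c y + cellMass D f h c (!y)) := by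
  have hs := sum_cellMass D f h
  have h0 := cellMass_nonneg D f h
  have hle : cellMass D f h c y + cellMass D f h c (!y) ≤ 1 := by
    cases c <;> cases y <;> simp <;>
    linarith [h0 false false, h0 false true, h0 true false, h0 true true]
  induction m with
  | zero =>
    have : cellError D f h 0 c y ≤ 1 := by
      unfold cellError
      refine (abs_le.mp (abs_integral_le_one _ fun s => ?_)).2
      split_ifs <;> simp
    have h3 : 0 ≤ cellMass D f h c (!y) / (cellMass D f h c y + cellMass D f h c (!y)) :=
      div_nonneg (h0 _ _) hpos.le
    simp; linarith
  | succ m ih =>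
    rw [cellError_succ]
    set P := cellMass D f h c y + cellMass D f h c (!y)
    have h4 := mul_le_mul_of_nonneg_left ih (sub_nonneg.mpr hle)
    have h5 : cellMass D f h c (!y) / P * P = cellMass D f h c (!y) := by field_simp
    rw [pow_succ]
    linarith

/-- The contribution of one cell to the loss of the cell rule. The first term accounts for the
event that no training point falls in the cell. -/
theorem cell_contribution_le (D : ProbabilityMeasure X) (f h : X → Bool) (m : ℕ) (c : Bool) {B : ℝ}
    (hB : 2 * (cellMass D f h c false * cellMass D f h c true) ≤
      (cellMass D f h c false + cellMass D f h c true) * B) (hB0 : 0 ≤ B) :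
    cellMass D f h c false * cellError D f h m c false +
      cellMass D f h c true * cellError D f h m c true ≤ 1 / (m + 1) + B := by
  have hs := sum_cellMass D f h
  have h0 := cellMass_nonneg D f h
  have hle : cellMass D f h c false + cellMass D f h c true ≤ 1 := by
    cases c <;> linarith [h0 false false, h0 false true, h0 true false, h0 true true]
  have e1 := cellError_le D f h m c false
  have e2 := cellError_le D f h m c true
  simp only [Bool.not_false, Bool.not_true] at e1 e2
  rw [add_comm (cellMass D f h c true)] at e2
  rcases (add_nonneg (h0 c false) (h0 c true)).eq_or_lt with hz | hpos
  · have z1 : cellMass D f h c false = 0 := by linarith [h0 c false, h0 c true]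
    have z2 : cellMass D f h c true = 0 := by linarith [h0 c false, h0 c true]
    rw [z1, z2]
    have : (0 : ℝ) ≤ 1 / (m + 1) := by positivity
    linarith
  · have a1 := mul_le_mul_of_nonneg_left (e1 hpos) (h0 c false)
    have a2 := mul_le_mul_of_nonneg_left (e2 hpos) (h0 c true)
    have a3 := mul_one_sub_pow_le _ hpos.le hle m
    set p := cellMass D f h c false
    set q := cellMass D f h c true
    have a4 : p * (q / (p + q)) + q * (p / (p + q)) ≤ B := by
      have : p * (q / (p + q)) + q * (p / (p + q)) = 2 * (p * q) / (p + q) := by ring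
      rw [this, div_le_iff₀ hpos]; linarith
    linarith

theorem expectedLoss_cellRule (D : ProbabilityMeasure X) (f h : X → Bool) (m : ℕ) :
    expectedLoss (cellRule f).toRandomized D h m =
      cellMass D f h false false * cellError D f h m false false +
        cellMass D f h false true * cellError D f h m false true +
      (cellMass D f h true false * cellError D f h m true false +
        cellMass D f h true true * cellError D f h m true true) := by
  rw [← integral_cells D f h (cellError D f h m)]
  unfold expectedLoss loss cellError
  rw [integral_integral_swap]
  · congr 1; funext x; congr 1; funext s
    simp only [Learner.toRandomized, cellRule, PMF.pure_apply]
    by_cases hx : cellPredict f m (labelSample h s) (f x) = !h x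
    · simp [hx]
    · simp [hx, Ne.symm hx]
  · refine integrable_of_abs_le_one _ fun y => ?_
    exact abs_toReal_pmf_le_one _ _

/-- Whatever the marginal and the ground truth, the cell rule does not do much worse than a coin. -/
theorem expectedLoss_cellRule_le_half (D : ProbabilityMeasure X) (f h : X → Bool) (m : ℕ) :
    expectedLoss (cellRule f).toRandomized D h m ≤ 1 / 2 + 2 / (m + 1) := by
  have hs := sum_cellMass D f h
  have h0 := cellMass_nonneg D f h
  have k : ∀ c, _ := fun c => cell_contribution_le D f h m c
    (B := (cellMass D f h c false + cellMass D f h c true) / 2)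
    (by nlinarith [sq_nonneg (cellMass D f h c false - cellMass D f h c true)])
    (by linarith [h0 c false, h0 c true])
  rw [expectedLoss_cellRule]
  have := k false
  have := k true
  have : (2 : ℝ) / (m + 1) = 1 / (m + 1) + 1 / (m + 1) := by ring
  linarith

/-- If the ground truth is nearly constant on each of the two cells, the cell rule has small
loss. -/
theorem expectedLoss_cellRule_le (D : ProbabilityMeasure X) (f h : X → Bool) (m : ℕ)
    (κ : Bool → Bool) :
    expectedLoss (cellRule f).toRandomized D h m ≤
      2 * (D : Measure X).real {x | h x ≠ κ (f x)} + 2 / (m + 1) := by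
  have h0 := cellMass_nonneg D f h
  have k : ∀ c, _ := fun c => cell_contribution_le D f h m c
    (B := 2 * cellMass D f h c (!κ c))
    (by cases κ c <;> simp <;> nlinarith [h0 c false, h0 c true, mul_nonneg (h0 c false) (h0 c true)])
    (by linarith [h0 c (!κ c)])
  have hB : (D : Measure X).real {x | h x ≠ κ (f x)} =
      cellMass D f h false (!κ false) + cellMass D f h true (!κ true) := by
    have h1 := integral_cells D f h fun c y => if y ≠ κ c then 1 else 0
    have h2 : ∫ x, (if h x ≠ κ (f x) then (1 : ℝ) else 0) ∂(D : Measure X) =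
        (D : Measure X).real {x | h x ≠ κ (f x)} := by
      rw [← integral_indicator_one .of_discrete]
      congr 1; funext x; simp [Set.indicator_apply]
    rw [← h2, h1]
    cases κ false <;> cases κ true <;> simp
  rw [expectedLoss_cellRule, hB]
  have := k false
  have := k true
  have : (2 : ℝ) / (m + 1) = 1 / (m + 1) + 1 / (m + 1) := by ring
  linarith

end CellRule

/-! ### Samples without repetition -/

section Distinct

variable {X : Type}

/-- The sample consists of distinct points of `U`. -/
def IsDistinctIn (U : Set X) {m : ℕ} (s : Fin m → X) : Prop :=
  Function.Injective s ∧ ∀ i, s i ∈ U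

theorem isDistinctIn_cons {U : Set X} {m : ℕ} {x : X} {s : Fin m → X} :
    IsDistinctIn U (Fin.cons x s : Fin (m + 1) → X) ↔ x ∈ U ∧ IsDistinctIn (U \ {x}) s := by
  unfold IsDistinctIn
  rw [Fin.cons_injective_iff, Fin.forall_fin_succ]
  simp only [Fin.cons_zero, Fin.cons_succ, Set.mem_sdiff, Set.mem_singleton_iff, Set.mem_range,
    not_exists, forall_and]
  tauto

variable [MeasurableSpace X]

open Classical in
/-- The probability that `m` i.i.d. samples are distinct points of `U`. -/
noncomputable def distinctProb (D : ProbabilityMeasure X) (U : Set X) (m : ℕ) : ℝ :=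
  ∫ s, (if IsDistinctIn U s then 1 else 0) ∂(sampleLaw D m)

variable [DiscreteMeasurableSpace X] [Countable X]

omit [DiscreteMeasurableSpace X] [Countable X] in
theorem distinctProb_mem_Icc (D : ProbabilityMeasure X) (U : Set X) (m : ℕ) :
    0 ≤ distinctProb D U m ∧ distinctProb D U m ≤ 1 := by
  unfold distinctProb
  refine ⟨integral_nonneg fun s => ?_, (abs_le.mp (abs_integral_le_one _ fun s => ?_)).2⟩
  · dsimp only [Pi.zero_apply]
    split_ifs <;> simp
  · split_ifs <;> simp

omit [DiscreteMeasurableSpace X] [Countable X] in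
theorem distinctProb_zero (D : ProbabilityMeasure X) (U : Set X) : distinctProb D U 0 = 1 := by
  have : ∀ s : Fin 0 → X, IsDistinctIn U s := fun s =>
    ⟨Function.injective_of_subsingleton s, fun i => i.elim0⟩
  simp [distinctProb, this]

/-- After the first sample `x`, the others have to be distinct points of `U \ {x}`. This is why
`distinctProb` is set up for arbitrary `U`. -/
theorem distinctProb_succ (D : ProbabilityMeasure X) (U : Set X) (m : ℕ) :
    distinctProb D U (m + 1) =
      ∫ x in U, distinctProb D (U \ {x}) m ∂(D : Measure X) := by
  classical
  unfold distinctProb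
  rw [integral_sampleLaw_succ _ _ _ fun s => by split_ifs <;> simp,
    ← integral_indicator .of_discrete]
  congr 1; funext x
  by_cases hx : x ∈ U <;> simp [isDistinctIn_cons, hx]

theorem integrable_distinctProb_sdiff (D : ProbabilityMeasure X) (U V : Set X) (m : ℕ) :
    Integrable (fun x => distinctProb D (U \ {x}) m) ((D : Measure X).restrict V) :=
  integrable_of_abs_le_one _ fun x => by
    have := distinctProb_mem_Icc D (U \ {x}) m
    rw [abs_of_nonneg this.1]; exact this.2

/-- Union bound for collisions, when no point has mass more than `δ`. -/
theorem le_distinctProb (D : ProbabilityMeasure X) {δ : ℝ} (hδ : 0 ≤ δ)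
    (hD : ∀ x, (D : Measure X).real {x} ≤ δ) (m : ℕ) (U : Set X) :
    1 - m * (1 - (D : Measure X).real U) - m ^ 2 * δ ≤ distinctProb D U m := by
  induction m generalizing U with
  | zero => simp [distinctProb_zero]
  | succ m ih =>
    rw [distinctProb_succ]
    have hU : (D : Measure X).real U ≤ 1 := measureReal_le_one
    set u := (D : Measure X).real U with hu
    set Y : ℝ := m * (1 - u + δ) + m ^ 2 * δ with hY
    have hY0 : 0 ≤ Y := by
      have : 0 ≤ 1 - u := by linarith
      positivity
    have h1 : ∫ x in U, (1 - Y) ∂(D : Measure X) ≤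
        ∫ x in U, distinctProb D (U \ {x}) m ∂(D : Measure X) := by
      refine setIntegral_mono_on (integrable_const _) (integrable_distinctProb_sdiff _ _ _ _)
        .of_discrete fun x hx => (le_trans ?_ (ih (U \ {x})))
      have h2 : (D : Measure X).real (U \ {x}) = u - (D : Measure X).real {x} :=
        measureReal_sdiff (by simpa using hx) .of_discrete
      rw [h2, hY]
      nlinarith [hD x, (Nat.cast_nonneg m : (0:ℝ) ≤ m)]
    rw [setIntegral_const, smul_eq_mul] at h1
    refine le_trans ?_ h1
    push_cast
    nlinarith [mul_nonneg hY0 (sub_nonneg.mpr hU), mul_nonneg (Nat.cast_nonneg m : (0:ℝ) ≤ m) hδ,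
      measureReal_nonneg (μ := (D : Measure X)) (s := U)]

/-- Among `u + t` samples, each of the first `u` points is missed by the last `t` ones.
The factor `1 - D{x}` is all that is needed from distinctness. -/
theorem distinctProb_le (D : ProbabilityMeasure X) (t u : ℕ) (U : Set X) :
    distinctProb D U (t + u) ≤ (D : Measure X).real U ^ t *
      (∫ x in U, (1 - (D : Measure X).real {x}) ^ t ∂(D : Measure X)) ^ u := by
  have hp : ∀ x, 0 ≤ 1 - (D : Measure X).real {x} := fun x =>
    sub_nonneg.mpr measureReal_le_one
  have hint : ∀ V : Set X, Integrable (fun x => (1 - (D : Measure X).real {x}) ^ t)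
      ((D : Measure X).restrict V) := fun V => integrable_of_abs_le_one _ fun x => by
    rw [abs_of_nonneg (pow_nonneg (hp x) t)]
    exact pow_le_one₀ (hp x) (by linarith [measureReal_nonneg (μ := (D : Measure X)) (s := {x})])
  have hI : ∀ V : Set X, 0 ≤ ∫ x in V, (1 - (D : Measure X).real {x}) ^ t ∂(D : Measure X) :=
    fun V => integral_nonneg fun x => pow_nonneg (hp x) t
  induction u generalizing U with
  | zero =>
    rw [pow_zero, mul_one, add_zero]
    clear hint hI
    induction t generalizing U with
    | zero => simp [distinctProb_zero]
    | succ t ih =>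
      rw [distinctProb_succ]
      have h1 : ∫ x in U, distinctProb D (U \ {x}) t ∂(D : Measure X) ≤
          ∫ x in U, (D : Measure X).real U ^ t ∂(D : Measure X) := by
        refine setIntegral_mono_on (integrable_distinctProb_sdiff _ _ _ _) (integrable_const _)
          .of_discrete fun x hx => (ih _).trans ?_
        exact pow_le_pow_left₀ measureReal_nonneg (measureReal_mono Set.sdiff_subset) t
      rw [setIntegral_const, smul_eq_mul] at h1
      rw [pow_succ]; linarith
  | succ u ih =>
    rw [← add_assoc, distinctProb_succ, pow_succ]
    set I := ∫ x in U, (1 - (D : Measure X).real {x}) ^ t ∂(D : Measure X)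
    have h1 : ∫ x in U, distinctProb D (U \ {x}) (t + u) ∂(D : Measure X) ≤
        ∫ x in U, (D : Measure X).real U ^ t * I ^ u * (1 - (D : Measure X).real {x}) ^ t
          ∂(D : Measure X) := by
      refine setIntegral_mono_on (integrable_distinctProb_sdiff _ _ _ _)
        ((hint U).const_mul _) .of_discrete fun x hx => (ih _).trans ?_
      have h2 : (D : Measure X).real (U \ {x}) =
          (D : Measure X).real U - (D : Measure X).real {x} :=
        measureReal_sdiff (by simpa using hx) .of_discrete
      have h3 : (D : Measure X).real (U \ {x}) ^ t ≤
          (D : Measure X).real U ^ t * (1 - (D : Measure X).real {x}) ^ t := by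
        rw [← mul_pow]
        refine pow_le_pow_left₀ measureReal_nonneg ?_ t
        rw [h2]
        have : (D : Measure X).real U ≤ 1 := measureReal_le_one
        nlinarith [measureReal_nonneg (μ := (D : Measure X)) (s := {x})]
      have h4 : (∫ x in U \ {x}, (1 - (D : Measure X).real {x}) ^ t ∂(D : Measure X)) ^ u ≤ I ^ u :=
        pow_le_pow_left₀ (hI _) (setIntegral_mono_set (hint U)
          (Filter.Eventually.of_forall fun y => pow_nonneg (hp y) t)
          (Set.sdiff_subset.eventuallyLE)) u
      calc _ ≤ ((D : Measure X).real U ^ t * (1 - (D : Measure X).real {x}) ^ t) * I ^ u :=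
            mul_le_mul h3 h4 (pow_nonneg (hI _) u)
              (mul_nonneg (pow_nonneg measureReal_nonneg t) (pow_nonneg (hp x) t))
        _ = _ := by ring
    rw [integral_const_mul] at h1
    linarith

/-- If the complement of `T` and a set of at most `k` points of `T` together have mass at least `ρ`,
then `2 * t` samples from `D` are unlikely to be distinct points of `T`, as soon as `t ^ 2` is large
compared with `k / ρ ^ 2`. -/
theorem distinctProb_le_quarter (D : ProbabilityMeasure X) (T : Set X) (E : Finset X) {k ρ : ℝ}
    (hk : 0 < k) (hE : (E.card : ℝ) ≤ k) (hρ : 0 < ρ)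
    (hD : 2 * ρ ≤ (D : Measure X).real (Tᶜ ∪ E)) (t : ℕ) (ht : 6 ≤ t * ρ)
    (htk : 6 * k ≤ t ^ 2 * ρ ^ 2) :
    distinctProb D T (t + t) ≤ 1 / 4 := by
  classical
  have hρ1 : 2 * ρ ≤ 1 := hD.trans measureReal_le_one
  set τ : ℝ := ρ / k with hτ
  have hτ0 : 0 < τ := by positivity
  set θ : ℝ := t * τ / (1 + t * τ) with hθ
  have hθ0 : 0 ≤ θ := by positivity
  have hθ1 : θ ≤ 1 := by rw [hθ, div_le_one (by positivity)]; linarith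
  -- The points of `E` with mass below `τ = ρ / k` have total mass at most `ρ`.
  set L : Finset X := E.filter fun x => (D : Measure X).real {x} < τ
  set B : Set X := Tᶜ ∪ {x | x ∈ E ∧ τ ≤ (D : Measure X).real {x}} with hB
  have hL : (D : Measure X).real L ≤ ρ := by
    rw [← sum_measureReal_singleton]
    calc ∑ x ∈ L, (D : Measure X).real {x} ≤ L.card • τ :=
          Finset.sum_le_card_nsmul _ _ _ fun x hx => (Finset.mem_filter.mp hx).2.le
      _ ≤ k * τ := by
          rw [nsmul_eq_mul]
          refine mul_le_mul_of_nonneg_right (le_trans ?_ hE) hτ0.le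
          exact_mod_cast Finset.card_filter_le _ _
      _ = ρ := by rw [hτ]; field_simp
  have hBρ : ρ ≤ (D : Measure X).real B := by
    have h1 : (Tᶜ ∪ E : Set X) ⊆ B ∪ L := by
      intro x hx
      simp only [hB, L, Set.mem_union, Set.mem_ofPred_eq, Finset.coe_filter, Finset.mem_coe] at hx ⊢
      rcases hx with hx | hx
      · exact .inl (.inl hx)
      · rcases lt_or_ge ((D : Measure X).real {x}) τ with h | h
        · exact .inr ⟨hx, h⟩
        · exact .inl (.inr ⟨hx, h⟩)
    have h2 := (measureReal_mono h1).trans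
      (measureReal_union_le (μ := (D : Measure X)) B (L : Set X))
    linarith
  have hp : ∀ x, 0 ≤ 1 - (D : Measure X).real {x} := fun x =>
    sub_nonneg.mpr measureReal_le_one
  have hq : ∀ x, 1 - (D : Measure X).real {x} ≤ 1 := fun x => by
    linarith [measureReal_nonneg (μ := (D : Measure X)) (s := {x})]
  have hI : ∫ x in T, (1 - (D : Measure X).real {x}) ^ t ∂(D : Measure X) ≤
      1 - ρ * θ := by
    have h1 : ∫ x in T, (1 - (D : Measure X).real {x}) ^ t ∂(D : Measure X) ≤
        ∫ x, (1 - B.indicator (fun _ => θ) x) ∂(D : Measure X) := by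
      rw [← integral_indicator .of_discrete]
      refine integral_mono (integrable_of_abs_le_one _ fun x => ?_)
        (integrable_of_abs_le_one _ fun x => ?_) fun x => ?_
      · by_cases hx : x ∈ T
        · rw [Set.indicator_of_mem hx, abs_of_nonneg (pow_nonneg (hp x) t)]
          exact pow_le_one₀ (hp x) (hq x)
        · simp [Set.indicator_of_notMem hx]
      · by_cases hx : x ∈ B
        · rw [Set.indicator_of_mem hx, abs_le]; constructor <;> linarith
        · simp [Set.indicator_of_notMem hx]
      · by_cases hx : x ∈ T
        · rw [Set.indicator_of_mem hx]
          by_cases hxB : x ∈ B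
          · rw [Set.indicator_of_mem hxB]
            have h3 : τ ≤ (D : Measure X).real {x} := by
              rcases hxB with h | h
              · exact absurd hx h
              · exact h.2
            have hτ1 : τ ≤ 1 := h3.trans measureReal_le_one
            have h4 := one_sub_pow_le τ hτ0.le hτ1 t
            have h5 : 1 - θ = 1 / (1 + t * τ) := by rw [hθ]; field_simp; ring
            rw [h5]
            exact (pow_le_pow_left₀ (hp x) (by linarith) t).trans h4
          · simp only [Set.indicator_of_notMem hxB, sub_zero]
            exact pow_le_one₀ (hp x) (hq x)
        · simp only [Set.indicator_of_notMem hx]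
          by_cases hxB : x ∈ B
          · rw [Set.indicator_of_mem hxB]; linarith
          · simp [Set.indicator_of_notMem hxB]
    refine h1.trans ?_
    rw [integral_sub (integrable_const _) ((integrable_const θ).indicator .of_discrete),
      integral_indicator .of_discrete, setIntegral_const]
    simp only [integral_const, probReal_univ, smul_eq_mul, one_mul]
    nlinarith
  have hI0 : 0 ≤ ∫ x in T, (1 - (D : Measure X).real {x}) ^ t ∂(D : Measure X) :=
    integral_nonneg fun x => pow_nonneg (hp x) t
  have hρθ : ρ * θ ≤ 1 := by nlinarith
  have hfin : 3 ≤ t * (ρ * θ) := by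
    have hτk : τ * k = ρ := by rw [hτ]; field_simp
    have h6 : 6 ≤ (t : ℝ) ^ 2 * ρ * τ := by
      have : (t : ℝ) ^ 2 * ρ * τ = t ^ 2 * ρ ^ 2 / k := by rw [hτ]; ring
      rw [this, le_div_iff₀ hk]; exact htk
    have : (t : ℝ) * (ρ * θ) = (t ^ 2 * ρ * τ) / (1 + t * τ) := by rw [hθ]; ring
    rw [this, le_div_iff₀ (by positivity)]
    have h7 : 6 * ((t : ℝ) * τ) ≤ t * ρ * (t * τ) :=
      mul_le_mul_of_nonneg_right ht (by positivity)
    nlinarith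
  calc distinctProb D T (t + t) ≤ _ := distinctProb_le D t t T
    _ ≤ 1 * (1 - ρ * θ) ^ t := by
        refine mul_le_mul ?_ (pow_le_pow_left₀ hI0 hI t) (pow_nonneg hI0 t) zero_le_one
        exact pow_le_one₀ measureReal_nonneg measureReal_le_one
    _ ≤ 1 / (1 + t * (ρ * θ)) := by
        rw [one_mul]; exact one_sub_pow_le _ (by positivity) hρθ t
    _ ≤ 1 / 4 := one_div_le_one_div_of_le (by norm_num) (by linarith)

end Distinct

/-! ### A certified learner for a known marginal -/

section Certificate

variable {X : Type} [MeasurableSpace X] [DiscreteMeasurableSpace X] [Countable X]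

omit [DiscreteMeasurableSpace X] [Countable X] in
theorem loss_mem_Icc (f : X → PMF Bool) (D : ProbabilityMeasure X) (h : X → Bool) :
    0 ≤ loss f D h ∧ loss f D h ≤ 1 := by
  refine ⟨integral_nonneg fun _ => ENNReal.toReal_nonneg,
    (abs_le.mp (abs_integral_le_one _ fun x => abs_toReal_pmf_le_one _ _)).2⟩

omit [DiscreteMeasurableSpace X] [Countable X] in
theorem expectedLoss_le_one (A : RandomizedLearner X) (D : ProbabilityMeasure X) (h : X → Bool)
    (m : ℕ) : expectedLoss A D h m ≤ 1 :=
  (abs_le.mp (abs_integral_le_one _ fun s => by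
    have := loss_mem_Icc (A m (labelSample h s)) D h
    rw [abs_of_nonneg this.1]; exact this.2)).2

omit [DiscreteMeasurableSpace X] [Countable X] in
theorem expectedLoss_le_errorRate {H : Set (X → Bool)} (A : RandomizedLearner X)
    (D : ProbabilityMeasure X) {h : X → Bool} (hh : h ∈ H) (m : ℕ) :
    expectedLoss A D h m ≤ errorRate H A D m :=
  le_ciSup (f := fun h : H => expectedLoss A D h m)
    ⟨1, by rintro _ ⟨h, rfl⟩; exact expectedLoss_le_one A D h m⟩ ⟨h, hh⟩

open Classical in
/-- The certifier for sample size `m₀` that outputs `c` if the sample consists of distinct points of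
`T`. In all other cases it outputs the trivial bound `1`. -/
noncomputable def distinctCertifier (T : Set X) (m₀ : ℕ) (c : unitInterval) : Certifier X :=
  fun m s => if m = m₀ ∧ IsDistinctIn T s then c else 1

omit [DiscreteMeasurableSpace X] [Countable X] in
theorem expectedCertificate_of_ne (T : Set X) {m m₀ : ℕ} (hm : m ≠ m₀) (c : unitInterval)
    (D : ProbabilityMeasure X) :
    expectedCertificate (distinctCertifier T m₀ c) D m = 1 := by
  simp [expectedCertificate, distinctCertifier, hm]

theorem expectedCertificate_self (T : Set X) (m : ℕ) (c : unitInterval)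
    (D : ProbabilityMeasure X) :
    expectedCertificate (distinctCertifier T m c) D m = 1 - (1 - c) * distinctProb D T m := by
  classical
  have h : ∀ s : Fin m → X, ((distinctCertifier T m c m s : unitInterval) : ℝ) =
      1 - (1 - c) * (if IsDistinctIn T s then 1 else 0) := by
    intro s
    by_cases hs : IsDistinctIn T s <;> simp [distinctCertifier, hs]
  unfold expectedCertificate distinctProb
  simp_rw [h]
  rw [integral_sub (integrable_const _), integral_const_mul]
  · simp
  · refine Integrable.const_mul (integrable_of_abs_le_one _ fun s => ?_) _
    split_ifs <;> simp

/-- If, up to at most `k` exceptional points of `T`, each hypothesis is on `T` a function of `f`,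
then the cell rule for `f` has a sound certificate that is small when the sample looks as if it came
from a spread-out distribution on `T`. -/
theorem isSoundCertifier_cellRule {H : Set (X → Bool)} (f : X → Bool) (T : Set X) {k : ℝ}
    (hk : 0 < k)
    (hH : ∀ h ∈ H, ∃ (κ : Bool → Bool) (E : Finset X), (E.card : ℝ) ≤ k ∧
      ∀ x ∈ T, h x ≠ κ (f x) → x ∈ E)
    (t : ℕ) (c : unitInterval) (htc : 48 ≤ t * (c : ℝ)) (htk : 384 * k ≤ t ^ 2 * (c : ℝ) ^ 2) :
    IsSoundCertifier H (cellRule f).toRandomized (distinctCertifier T (t + t) c) := by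
  intro D m
  have hc0 : (0 : ℝ) ≤ c := c.2.1
  have hc1 : (c : ℝ) ≤ 1 := c.2.2
  have hcpos : (0 : ℝ) < c := by
    rcases hc0.eq_or_lt with h | h
    · rw [← h] at htc; norm_num at htc
    · exact h
  by_cases hm : m = t + t
  swap
  · rw [expectedCertificate_of_ne T hm]
    exact Real.iSup_le (fun h => expectedLoss_le_one _ _ _ _) zero_le_one
  subst hm
  rw [expectedCertificate_self]
  have hG := distinctProb_mem_Icc D T (t + t)
  refine Real.iSup_le (fun h => ?_) (by nlinarith)
  obtain ⟨κ, E, hEk, hE⟩ := hH h h.2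
  have ht : (2 : ℝ) / ((t + t : ℕ) + 1) ≤ c / 4 := by
    rw [div_le_div_iff₀ (by positivity) (by norm_num)]
    push_cast; nlinarith
  rcases lt_or_ge ((D : Measure X).real (Tᶜ ∪ E)) (c / 4) with hB | hB
  · have h1 := expectedLoss_cellRule_le D f h (t + t) κ
    have h2 : (D : Measure X).real {x | (h : X → Bool) x ≠ κ (f x)} ≤
        (D : Measure X).real (Tᶜ ∪ E) := measureReal_mono fun x hx => by
      by_cases hxT : x ∈ T
      · exact .inr (hE x hxT hx)
      · exact .inl hxT
    nlinarith
  · have h1 := expectedLoss_cellRule_le_half D f h (t + t)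
    have h2 := distinctProb_le_quarter D T E hk hEk (ρ := c / 8) (by positivity) (by linarith) t
      (by linarith) (by nlinarith)
    nlinarith

/-- A distribution on `T` without heavy points gets a small certificate. -/
theorem expectedCertificate_le (T : Set X) (m : ℕ) (c : unitInterval) (D : ProbabilityMeasure X)
    {δ : ℝ} (hδ : 0 ≤ δ) (hD : ∀ x, (D : Measure X).real {x} ≤ δ)
    (hT : (D : Measure X).real T = 1) :
    expectedCertificate (distinctCertifier T m c) D m ≤ c + m ^ 2 * δ := by
  rw [expectedCertificate_self]
  have h1 := le_distinctProb D hδ hD m T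
  rw [hT] at h1
  have hc0 : (0 : ℝ) ≤ c := c.2.1
  have hc1 : (c : ℝ) ≤ 1 := c.2.2
  have : 0 ≤ (m : ℝ) ^ 2 * δ := by positivity
  nlinarith [mul_le_mul_of_nonneg_left h1 (sub_nonneg.mpr hc1)]

omit [DiscreteMeasurableSpace X] [Countable X] in
/-- A smart learner competes with each soundly certified learner. -/
theorem IsRelativelySmart.errorRate_le {H : Set (X → Bool)} {α : ℝ}
    {σ : ℕ → Set.Ioo (0 : ℝ) 1 → ℕ} {A : RandomizedLearner X} (hA : IsRelativelySmart H α σ A)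
    {A' : Learner X} {C : Certifier X} (hC : IsSoundCertifier H A'.toRandomized C)
    (D : ProbabilityMeasure X) (m : ℕ) (η : Set.Ioo (0 : ℝ) 1) :
    errorRate H A D (σ m η) ≤ α * expectedCertificate C D m + η := by
  have hmem : ∀ (D : ProbabilityMeasure X) m, expectedCertificate C D m ∈ Set.Icc (0 : ℝ) 1 :=
    fun D m => ⟨integral_nonneg fun s => (C m s).2.1,
      (abs_le.mp (abs_integral_le_one _ fun s => by
        rw [abs_of_nonneg (C m s).2.1]; exact (C m s).2.2)).2⟩
  exact hA (fun D m => ⟨expectedCertificate C D m, hmem D m⟩)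
    (fun D => ⟨A', C, hC, fun m => le_rfl⟩) D m η

end Certificate

/-! ### Error of a learner that does not know the marginal -/

section LowerBound

variable {X : Type} [MeasurableSpace X] [DiscreteMeasurableSpace X] [Countable X]
  {K : Type} [MeasurableSpace K] [DiscreteMeasurableSpace K] [Countable K]

/-- The law of `p a` for `a ∼ μ`. -/
noncomputable def pushLaw (μ : ProbabilityMeasure K) (p : K → X) : ProbabilityMeasure X :=
  μ.map (f := p) Measurable.of_discrete.aemeasurable

theorem expectedLoss_pushLaw (A : RandomizedLearner X) (μ : ProbabilityMeasure K) (p : K → X)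
    (h : X → Bool) (m : ℕ) :
    expectedLoss A (pushLaw μ p) h m =
      ∫ a, ∫ b, (A m (labelSample h (p ∘ a)) (p b) (!(h (p b)))).toReal ∂(μ : Measure K)
        ∂(sampleLaw μ m) := by
  have h1 : ((pushLaw μ p : ProbabilityMeasure X) : Measure X) = (μ : Measure K).map p := rfl
  have h2 : sampleLaw (pushLaw μ p) m = (sampleLaw μ m).map fun a => p ∘ a := by
    unfold sampleLaw
    have : IsProbabilityMeasure ((μ : Measure K).map p) :=
      Measure.isProbabilityMeasure_map Measurable.of_discrete.aemeasurable
    rw [h1, ← Measure.pi_map_pi fun _ => Measurable.of_discrete.aemeasurable]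
    rfl
  unfold expectedLoss loss
  rw [h2, integral_map Measurable.of_discrete.aemeasurable
    Measurable.of_discrete.aestronglyMeasurable]
  congr 1; funext a
  rw [h1, integral_map Measurable.of_discrete.aemeasurable
    Measurable.of_discrete.aestronglyMeasurable]

theorem toReal_bool_add_not (q : PMF Bool) (y : Bool) : (q y).toReal + (q (!y)).toReal = 1 := by
  rw [← ENNReal.toReal_add (q.apply_ne_top _) (q.apply_ne_top _)]
  have h := q.tsum_coe
  rw [tsum_bool] at h
  cases y
  · simp [h]
  · rw [add_comm] at h; simp [h]

/-- Suppose that, for any `m` sampled parameters and another parameter `b`, the members `v` of a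
finite family can be permuted without any effect on what is observed, except that the label at `b`
is flipped. Then on average over the family a learner errs half of the time when `b` is new. -/
theorem exists_le_expectedLoss {V : Type} [Finite V] [Nonempty V] (A : RandomizedLearner X)
    (μ : ProbabilityMeasure K) {δ : ℝ} (hμ : ∀ a, (μ : Measure K).real {a} ≤ δ)
    (p : V → K → X) (h : V → X → Bool) (m : ℕ)
    (hflip : ∀ (a : Fin m → K) (b : K), b ∉ Set.range a → ∃ e : Equiv.Perm V, ∀ v,
      (∀ i, p (e v) (a i) = p v (a i) ∧ h (e v) (p v (a i)) = h v (p v (a i))) ∧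
      p (e v) b = p v b ∧ h (e v) (p v b) = !(h v (p v b))) :
    ∃ v, (1 - m * δ) / 2 ≤ expectedLoss A (pushLaw μ (p v)) (h v) m := by
  classical
  have := Fintype.ofFinite V
  by_contra! hcon
  have hsum : ∑ v, expectedLoss A (pushLaw μ (p v)) (h v) m <
      Fintype.card V * ((1 - m * δ) / 2) := by
    have := Finset.sum_lt_sum_of_nonempty (Finset.univ_nonempty (α := V)) fun v _ => hcon v
    simpa using this
  set err : V → (Fin m → K) → K → ℝ := fun v a b =>
    (A m (labelSample (h v) (p v ∘ a)) (p v b) (!(h v (p v b)))).toReal with herr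
  have herr1 : ∀ v a b, |err v a b| ≤ 1 := fun v a b => abs_toReal_pmf_le_one _ _
  have hpt : ∀ a b, b ∉ Set.range a → ∑ v, err v a b = Fintype.card V / 2 := by
    intro a b hb
    obtain ⟨e, he⟩ := hflip a b hb
    have h1 : ∀ v, err v a b + err (e v) a b = 1 := by
      intro v
      obtain ⟨hs, hpb, hhb⟩ := he v
      have h2 : labelSample (h (e v)) (p (e v) ∘ a) = labelSample (h v) (p v ∘ a) := by
        funext i
        simp [labelSample, (hs i).1, (hs i).2]
      simp only [herr]
      rw [h2, hpb, hhb, Bool.not_not, add_comm]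
      exact toReal_bool_add_not _ _
    have h3 : ∑ v, err (e v) a b = ∑ v, err v a b := Equiv.sum_comp e fun v => err v a b
    have h4 : ∑ v, (err v a b + err (e v) a b) = Fintype.card V := by simp [h1]
    rw [Finset.sum_add_distrib, h3] at h4
    linarith
  have hinner : ∀ a : Fin m → K, Fintype.card V / 2 * (1 - m * δ) ≤
      ∑ v, ∫ b, err v a b ∂(μ : Measure K) := by
    intro a
    rw [← integral_finsetSum _ fun v _ => integrable_of_abs_le_one _ (herr1 v a)]
    have hr : (μ : Measure K).real (Set.range a) ≤ m * δ := by
      have h5 : Set.range a = ⋃ i, {a i} := by ext; simp [eq_comm]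
      rw [h5]
      refine (measureReal_iUnion_fintype_le _).trans ?_
      refine (Finset.sum_le_sum fun i _ => hμ (a i)).trans ?_
      simp
    have h6 : ∫ b, (Set.range a)ᶜ.indicator (fun _ => (Fintype.card V / 2 : ℝ)) b
        ∂(μ : Measure K) ≤ ∫ b, ∑ v, err v a b ∂(μ : Measure K) := by
      refine integral_mono ((integrable_const _).indicator .of_discrete)
        (integrable_finsetSum _ fun v _ => integrable_of_abs_le_one _ (herr1 v a)) fun b => ?_
      by_cases hb : b ∈ Set.range a
      · rw [Set.indicator_of_notMem (by simpa using hb)]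
        exact Finset.sum_nonneg fun v _ => ENNReal.toReal_nonneg
      · rw [Set.indicator_of_mem (by simpa using hb)]
        exact (hpt a b hb).ge
    refine le_trans ?_ h6
    rw [integral_indicator .of_discrete, setIntegral_const, smul_eq_mul,
      probReal_compl_eq_one_sub .of_discrete]
    have : (0 : ℝ) ≤ Fintype.card V / 2 := by positivity
    nlinarith
  have hint : ∀ v, Integrable (fun a => ∫ b, err v a b ∂(μ : Measure K)) (sampleLaw μ m) :=
    fun v => integrable_of_abs_le_one _ fun a => abs_integral_le_one _ (herr1 v a)
  have houter : Fintype.card V / 2 * (1 - m * δ) ≤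
      ∑ v, expectedLoss A (pushLaw μ (p v)) (h v) m := by
    simp_rw [expectedLoss_pushLaw]
    rw [← integral_finsetSum _ fun v _ => hint v]
    have := integral_mono (μ := sampleLaw μ m) (integrable_const _)
      (integrable_finsetSum _ fun v _ => hint v) hinner
    simpa using this
  linarith

end LowerBound

/-! ### Curves in planes over fields of characteristic two -/

section Curves

open Polynomial

/-- The field with `2 ^ r` elements (for `r ≠ 0`). -/
abbrev BinField (r : ℕ) : Type := GaloisField 2 r

/-- The domain: the disjoint union of the affine planes over the fields of characteristic two. -/
def PlaneDomain : Type := Σ r : ℕ, BinField r × BinField r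

instance : Countable PlaneDomain :=
  inferInstanceAs (Countable (Σ r : ℕ, BinField r × BinField r))

instance PlaneDomain.measurableSpace : MeasurableSpace PlaneDomain := ⊤

instance : DiscreteMeasurableSpace PlaneDomain := ⟨fun _ => trivial⟩

/-- A choice of one element from each pair `{y, y + 1}`, by an arbitrary well-ordering. -/
noncomputable def sign {r : ℕ} (y : BinField r) : Bool :=
  open Classical in decide (WellOrderingRel y (y + 1))

theorem sign_add_one {r : ℕ} (y : BinField r) : sign (y + 1) = !sign y := by
  have h1 : y + 1 + 1 = y := by rw [add_assoc, CharTwo.add_self_eq_zero, add_zero]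
  have h2 : y ≠ y + 1 := by simp
  unfold sign
  rw [h1]
  by_cases h : WellOrderingRel y (y + 1)
  · simp [h, asymm h]
  · have := (trichotomous_of WellOrderingRel y (y + 1)).resolve_left h |>.resolve_left h2
    simp [h, this]

/-- The curve `a ↦ (a, g(a) * (g(a) + 1))`. The second coordinate determines `g(a)` only up to
adding `1`. -/
noncomputable def curve (r : ℕ) (g : (BinField r)[X]) (a : BinField r) : PlaneDomain :=
  ⟨r, a, g.eval a * (g.eval a + 1)⟩

theorem curve_eq_curve_iff {r : ℕ} {g g' : (BinField r)[X]} {a b : BinField r} :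
    curve r g a = curve r g' b ↔
      a = b ∧ (g'.eval a = g.eval a ∨ g'.eval a = g.eval a + 1) := by
  change (⟨r, a, g.eval a * (g.eval a + 1)⟩ : Σ r : ℕ, BinField r × BinField r) =
    ⟨r, b, g'.eval b * (g'.eval b + 1)⟩ ↔ _
  simp only [Sigma.mk.injEq, heq_eq_eq, Prod.mk.injEq, true_and]
  refine and_congr_right fun hab => ?_
  subst hab
  set y := g.eval a
  set z := g'.eval a
  have h2 : (2 : BinField r) = 0 := CharTwo.two_eq_zero
  constructor
  · intro h
    have h3 : (z - y) * (z - (y + 1)) = 0 := by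
      linear_combination -h + (z * y * -1 + y * (y + 1) - z) * h2
    rcases mul_eq_zero.mp h3 with h4 | h4
    · exact .inl (sub_eq_zero.mp h4)
    · exact .inr (sub_eq_zero.mp h4)
  · rintro (h | h) <;> rw [h]
    linear_combination -(y + 1) * h2

/-- The hypothesis of `g`: on the curve of `g`, the sign of `g(a)`; off the curve, `false`. -/
noncomputable def curveHyp (r : ℕ) (g : (BinField r)[X]) (x : PlaneDomain) : Bool :=
  open Classical in decide (∃ a, curve r g a = x ∧ sign (g.eval a) = true)

theorem curveHyp_curve (r : ℕ) (g : (BinField r)[X]) (a : BinField r) :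
    curveHyp r g (curve r g a) = sign (g.eval a) := by
  classical
  unfold curveHyp
  by_cases h : sign (g.eval a) = true
  · rw [h]; exact decide_eq_true ⟨a, rfl, h⟩
  · rw [Bool.not_eq_true] at h
    rw [h]
    refine decide_eq_false ?_
    rintro ⟨b, hb, hs⟩
    rw [(curve_eq_curve_iff.mp hb).1, h] at hs
    exact Bool.false_ne_true hs

theorem curveHyp_eq_true {r : ℕ} {g : (BinField r)[X]} {x : PlaneDomain}
    (h : curveHyp r g x = true) : ∃ a, curve r g a = x := by
  classical
  obtain ⟨a, ha, -⟩ := of_decide_eq_true h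
  exact ⟨a, ha⟩

/-- The bound on the degrees in the plane of order `2 ^ r`: almost `2 ^ r`, but of smaller order. -/
def degreeBound (r : ℕ) : ℕ := 2 ^ r / (r + 1)

/-- The hypothesis class: the hypotheses of all polynomials of degree less than `degreeBound r` over
the field with `2 ^ r` elements, for all `r`. -/
def curveClass : Set (PlaneDomain → Bool) :=
  {h | ∃ (r : ℕ) (g : (BinField r)[X]), g ∈ degreeLT (BinField r) (degreeBound r) ∧
    h = curveHyp r g}

/-- On the curve of `g`, each hypothesis agrees with that of `g`, with its negation, or with the
constant `false`, up to few exceptions: two distinct curves meet in few points. -/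
theorem exists_exceptions {r : ℕ} {g : (BinField r)[X]}
    (hg : g ∈ degreeLT (BinField r) (degreeBound r)) {h : PlaneDomain → Bool}
    (hh : h ∈ curveClass) :
    ∃ (κ : Bool → Bool) (E : Finset PlaneDomain), E.card ≤ 2 * degreeBound r ∧
      ∀ x ∈ Set.range (curve r g), h x ≠ κ (curveHyp r g x) → x ∈ E := by
  classical
  obtain ⟨r', g', hg', rfl⟩ := hh
  by_cases hr : r' = r
  swap
  · refine ⟨fun _ => false, ∅, by simp, ?_⟩
    rintro _ ⟨a, rfl⟩ hx
    obtain ⟨b, hb⟩ := curveHyp_eq_true (Bool.eq_true_of_not_eq_false hx)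
    exact absurd (congrArg Sigma.fst hb) hr
  subst hr
  by_cases h0 : g' = g
  · subst h0
    exact ⟨id, ∅, by simp, fun x _ hx => absurd rfl hx⟩
  by_cases h1 : g' = g + 1
  · refine ⟨Bool.not, ∅, by simp, ?_⟩
    rintro _ ⟨a, rfl⟩ hx
    refine absurd ?_ hx
    have h2 : curve r' g a = curve r' g' a := curve_eq_curve_iff.mpr ⟨rfl, by simp [h1]⟩
    rw [curveHyp_curve, h2, curveHyp_curve, h1, eval_add, eval_one, sign_add_one]
  · set q : (BinField r')[X] := (g' - g) * (g' - (g + 1)) with hq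
    have hq0 : q ≠ 0 := mul_ne_zero (sub_ne_zero.mpr h0) (sub_ne_zero.mpr h1)
    refine ⟨fun _ => false, q.roots.toFinset.image (curve r' g), ?_, ?_⟩
    · refine Finset.card_image_le.trans ((Multiset.toFinset_card_le _).trans
        ((card_roots' q).trans ?_))
      rw [mem_degreeLT] at hg hg'
      have hd : ∀ {p : (BinField r')[X]}, p.degree < degreeBound r' →
          p.natDegree ≤ degreeBound r' := fun hp => natDegree_le_of_degree_le hp.le
      have e1 : (g' - g).natDegree ≤ degreeBound r' :=
        (natDegree_sub_le _ _).trans (max_le (hd hg') (hd hg))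
      have e2 : (g' - (g + 1)).natDegree ≤ degreeBound r' := by
        refine (natDegree_sub_le _ _).trans (max_le (hd hg') ((natDegree_add_le _ _).trans
          (max_le (hd hg) ?_)))
        simp
      have e3 := natDegree_mul_le (p := g' - g) (q := g' - (g + 1))
      rw [← hq] at e3
      omega
    · rintro _ ⟨a, rfl⟩ hx
      obtain ⟨b, hb⟩ := curveHyp_eq_true (Bool.eq_true_of_not_eq_false hx)
      refine Finset.mem_image_of_mem _ ?_
      rw [Multiset.mem_toFinset, mem_roots hq0, IsRoot.def, hq, eval_mul, mul_eq_zero]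
      obtain ⟨-, h3⟩ := curve_eq_curve_iff.mp hb.symm
      rcases h3 with h3 | h3
      · left; simp [h3]
      · right; simp [h3]

/-- Fewer points than the degree bound do not tell the two possible labels at a further point
apart. -/
theorem exists_flip {r d m : ℕ} (hmd : m < d) (a : Fin m → BinField r) (b : BinField r)
    (hb : b ∉ Set.range a) :
    ∃ e : Equiv.Perm (degreeLT (BinField r) d), ∀ g : degreeLT (BinField r) d,
      (∀ i, curve r (e g) (a i) = curve r g (a i) ∧
        curveHyp r (e g) (curve r g (a i)) = curveHyp r g (curve r g (a i))) ∧
      curve r (e g) b = curve r g b ∧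
      curveHyp r (e g) (curve r g b) = !(curveHyp r g (curve r g b)) := by
  set P : (BinField r)[X] := ∏ i, (X - C (a i)) with hP
  have hPb : P.eval b ≠ 0 := by
    rw [hP, eval_prod, Finset.prod_ne_zero_iff]
    intro i _ h
    simp only [eval_sub, eval_X, eval_C, sub_eq_zero] at h
    exact hb ⟨i, h.symm⟩
  have hPd : P.natDegree = m := by
    rw [hP, natDegree_prod_of_monic _ _ fun i _ => monic_X_sub_C _]; simp
  -- The Lagrange polynomial that vanishes at the `a i` and is `1` at `b`.
  set L : (BinField r)[X] := P * C (P.eval b)⁻¹ with hL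
  have hLmem : L ∈ degreeLT (BinField r) d := by
    rw [mem_degreeLT]
    refine (degree_le_natDegree (p := L)).trans_lt ?_
    have := natDegree_mul_C_le P (P.eval b)⁻¹
    exact_mod_cast (this.trans hPd.le).trans_lt hmd
  have hLa : ∀ i, L.eval (a i) = 0 := by
    intro i
    rw [hL, eval_mul, hP, eval_prod, Finset.prod_eq_zero (Finset.mem_univ i) (by simp), zero_mul]
  have hLb : L.eval b = 1 := by simp [hL, hPb]
  refine ⟨Equiv.addRight ⟨L, hLmem⟩, fun g => ?_⟩
  have hcoe : ((Equiv.addRight (⟨L, hLmem⟩ : degreeLT (BinField r) d) g : degreeLT (BinField r) d) :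
      (BinField r)[X]) = g + L := rfl
  rw [hcoe]
  have ca : ∀ i, curve r ((g : (BinField r)[X]) + L) (a i) = curve r g (a i) := fun i =>
    curve_eq_curve_iff.mpr ⟨rfl, by simp [hLa]⟩
  have cb : curve r ((g : (BinField r)[X]) + L) b = curve r g b :=
    curve_eq_curve_iff.mpr ⟨rfl, .inr (by
      rw [eval_add, hLb, add_assoc, CharTwo.add_self_eq_zero, add_zero])⟩
  refine ⟨fun i => ⟨ca i, ?_⟩, cb, ?_⟩
  · rw [← ca i, curveHyp_curve, ca i, curveHyp_curve]
    simp [hLa]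
  · rw [← cb, curveHyp_curve, cb, curveHyp_curve, eval_add, hLb, sign_add_one]

end Curves

/-! ### Growth of the sample size -/

section Growth

open Filter Topology

theorem degreeBound_le (r : ℕ) : (degreeBound r : ℝ) ≤ 2 ^ r / (r + 1) := by
  have := Nat.cast_div_le (α := ℝ) (m := 2 ^ r) (n := r + 1)
  simpa [degreeBound] using this

theorem degreeBound_pos (r : ℕ) : 0 < degreeBound r :=
  Nat.div_pos Nat.lt_two_pow_self (Nat.succ_pos r)

/-- If `M` is of order `(2 ^ i) ^ (2 - β)`, then it is below the degree bound for the field with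
`2 ^ (2 * i + t)` elements. -/
theorem eventually_lt_degreeBound {β : ℝ} (hβ : 0 < β) (t : ℕ) (M : ℕ → ℕ)
    (hM : (fun m : ℕ => (M m : ℝ)) =O[atTop] fun m : ℕ => (m : ℝ) ^ (2 - β)) :
    ∀ᶠ i : ℕ in atTop, M (2 ^ i) < degreeBound (2 * i + t) := by
  have hpow : Tendsto (fun i : ℕ => 2 ^ i) atTop (atTop : Filter ℕ) :=
    tendsto_pow_atTop_atTop_of_one_lt (by norm_num)
  obtain ⟨K, hK⟩ := (hM.comp_tendsto hpow).bound
  set q : ℝ := (2 : ℝ) ^ (-β) with hq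
  have hq0 : 0 ≤ q := by positivity
  have hq1 : q < 1 := Real.rpow_lt_one_of_one_lt_of_neg (by norm_num) (by linarith)
  have lim : ∀ x : ℝ, 0 ≤ x → x < 1 →
      Tendsto (fun i : ℕ => (2 * (i : ℝ) + t + 1) * x ^ i) atTop (𝓝 0) := by
    intro x h0 h1
    have l1 := (tendsto_self_mul_const_pow_of_lt_one h0 h1).const_mul 2
    have l2 := (tendsto_pow_atTop_nhds_zero_of_lt_one h0 h1).const_mul ((t : ℝ) + 1)
    have := l1.add l2
    simp only [mul_zero, add_zero] at this
    refine this.congr fun i => ?_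
    ring
  have hlim : Tendsto (fun i : ℕ => K * ((2 * (i : ℝ) + t + 1) * q ^ i) +
      (2 * (i : ℝ) + t + 1) * (1 / 4) ^ i) atTop (𝓝 0) := by
    have := ((lim q hq0 hq1).const_mul K).add (lim (1 / 4) (by norm_num) (by norm_num))
    simpa using this
  filter_upwards [hK, hlim.eventually_le_const zero_lt_one] with i hi hsmall
  have h1 : (M (2 ^ i) : ℝ) ≤ K * (4 ^ i * q ^ i) := by
    have h2 : ((2 : ℝ) ^ i) ^ (2 - β) = 4 ^ i * q ^ i := by
      rw [← Real.rpow_natCast 2 i, ← Real.rpow_mul (by norm_num), sub_eq_add_neg, mul_add,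
        Real.rpow_add (by norm_num), mul_comm (i : ℝ) 2, mul_comm (i : ℝ) (-β),
        Real.rpow_mul (by norm_num), Real.rpow_mul (by norm_num), Real.rpow_natCast,
        Real.rpow_natCast, hq]
      norm_num
    have h3 : ‖((2 : ℝ) ^ i) ^ (2 - β)‖ = ((2 : ℝ) ^ i) ^ (2 - β) :=
      Real.norm_of_nonneg (by positivity)
    simp only [Function.comp, Nat.cast_pow, Nat.cast_ofNat, h3] at hi
    rw [h2] at hi
    simpa using hi
  rw [Nat.lt_iff_add_one_le, degreeBound, Nat.le_div_iff_mul_le (Nat.succ_pos _)]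
  have h4 : ((M (2 ^ i) : ℝ) + 1) * (2 * i + t + 1) ≤ 2 ^ (2 * i + t) := by
    have h5 : (4 : ℝ) ^ i * (1 / 4) ^ i = 1 := by rw [← mul_pow]; norm_num
    have h6 : (1 : ℝ) ≤ 2 ^ t := one_le_pow₀ (by norm_num)
    have hN : (0 : ℝ) ≤ 2 * (i : ℝ) + t + 1 := by positivity
    calc ((M (2 ^ i) : ℝ) + 1) * (2 * i + t + 1)
        ≤ (K * (4 ^ i * q ^ i) + 4 ^ i * (1 / 4) ^ i) * (2 * i + t + 1) := by
          rw [h5]; gcongr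
      _ = 4 ^ i * (K * ((2 * (i : ℝ) + t + 1) * q ^ i) + (2 * (i : ℝ) + t + 1) * (1 / 4) ^ i) := by
          ring
      _ ≤ 4 ^ i * 1 := by gcongr
      _ ≤ 4 ^ i * 2 ^ t := by gcongr
      _ = 2 ^ (2 * i + t) := by rw [pow_add, pow_mul]; norm_num
  exact_mod_cast h4

end Growth

/-! ### The two error rates on a curve -/

section Benchmark

open Polynomial

instance (r : ℕ) : MeasurableSpace (BinField r) := ⊤

instance (r : ℕ) : DiscreteMeasurableSpace (BinField r) := ⟨fun _ => trivial⟩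

/-- The uniform distribution on the field with `2 ^ r` elements. -/
noncomputable def uniformLaw (r : ℕ) : ProbabilityMeasure (BinField r) :=
  letI := Fintype.ofFinite (BinField r)
  ⟨(PMF.uniformOfFintype (BinField r)).toMeasure, inferInstance⟩

theorem uniformLaw_singleton {r : ℕ} (hr : r ≠ 0) (a : BinField r) :
    (uniformLaw r : Measure (BinField r)).real {a} = 1 / 2 ^ r := by
  let _ := Fintype.ofFinite (BinField r)
  have h1 : (uniformLaw r : Measure (BinField r)) {a} = (Fintype.card (BinField r) : ENNReal)⁻¹ := by
    change (PMF.uniformOfFintype (BinField r)).toMeasure {a} = _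
    rw [PMF.toMeasure_apply_singleton _ _ .of_discrete, PMF.uniformOfFintype_apply]
  have h2 : Fintype.card (BinField r) = 2 ^ r := by
    rw [← Nat.card_eq_fintype_card, GaloisField.card 2 r hr]
  rw [measureReal_def, h1, h2]
  simp

/-- The uniform distribution on the curve of `g`. -/
noncomputable def curveLaw (r : ℕ) (g : (BinField r)[X]) : ProbabilityMeasure PlaneDomain :=
  pushLaw (uniformLaw r) (curve r g)

theorem curveLaw_real (r : ℕ) (g : (BinField r)[X]) (s : Set PlaneDomain) :
    (curveLaw r g : Measure PlaneDomain).real s =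
      (uniformLaw r : Measure (BinField r)).real (curve r g ⁻¹' s) :=
  map_measureReal_apply Measurable.of_discrete .of_discrete

theorem curveLaw_singleton_le {r : ℕ} (hr : r ≠ 0) (g : (BinField r)[X]) (x : PlaneDomain) :
    (curveLaw r g : Measure PlaneDomain).real {x} ≤ 1 / 2 ^ r := by
  rw [curveLaw_real]
  by_cases hx : ∃ a, curve r g a = x
  · obtain ⟨a, rfl⟩ := hx
    rw [← uniformLaw_singleton hr a]
    exact measureReal_mono fun b hb => (curve_eq_curve_iff.mp hb).1
  · have : curve r g ⁻¹' {x} = ∅ := by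
      ext b; simpa using fun hb => hx ⟨b, hb⟩
    rw [this]; simp

theorem curveLaw_range (r : ℕ) (g : (BinField r)[X]) :
    (curveLaw r g : Measure PlaneDomain).real (Set.range (curve r g)) = 1 := by
  rw [curveLaw_real, Set.preimage_range, probReal_univ]

/-- With fewer samples than the degree bound, a learner fails on some curve. -/
theorem exists_le_errorRate (A : RandomizedLearner PlaneDomain) {r m : ℕ} (hr : r ≠ 0)
    (hm : m < degreeBound r) :
    ∃ g ∈ degreeLT (BinField r) (degreeBound r),
      1 / 4 ≤ errorRate curveClass A (curveLaw r g) m := by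
  have : Finite (degreeLT (BinField r) (degreeBound r)) :=
    Finite.of_equiv _ (degreeLTEquiv (BinField r) (degreeBound r)).toEquiv.symm
  obtain ⟨g, hg⟩ := exists_le_expectedLoss A (uniformLaw r)
    (fun a => (uniformLaw_singleton hr a).le)
    (fun g : degreeLT (BinField r) (degreeBound r) => curve r g)
    (fun g : degreeLT (BinField r) (degreeBound r) => curveHyp r g) m
    fun a b hb => exists_flip hm a b hb
  refine ⟨g, g.2, le_trans ?_ (hg.trans
    (expectedLoss_le_errorRate (H := curveClass) A (curveLaw r g) ⟨r, g, g.2, rfl⟩ m))⟩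
  have h1 : (m : ℝ) ≤ degreeBound r := by exact_mod_cast hm.le
  have h2 : (2 : ℝ) ^ r / (r + 1) ≤ 2 ^ r / 2 := by
    have : (1 : ℝ) ≤ r := by exact_mod_cast Nat.one_le_iff_ne_zero.mpr hr
    gcongr; linarith
  have h3 : (m : ℝ) * (1 / 2 ^ r) ≤ 1 / 2 := by
    rw [mul_one_div, div_le_iff₀ (by positivity)]
    linarith [degreeBound_le r]
  linarith

/-- For `m = 2 ^ (i + 1)` samples and curves with `m ^ 2 * 2 ^ t` points, a learner that knows the
curve can certify an error of at most `2 * 2 ^ (-t)`, for `i` large. -/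
theorem exists_certified {r t i : ℕ} (hr : r = 2 * (i + 1) + t) (h1 : (48 : ℝ) * 2 ^ t ≤ 2 ^ i)
    (h2 : (3072 : ℝ) * (2 ^ t) ^ 3 ≤ i) {g : (BinField r)[X]}
    (hg : g ∈ degreeLT (BinField r) (degreeBound r)) :
    ∃ (A : Learner PlaneDomain) (C : Certifier PlaneDomain),
      IsSoundCertifier curveClass A.toRandomized C ∧
      expectedCertificate C (curveLaw r g) (2 ^ (i + 1)) ≤ 2 / 2 ^ t := by
  have ht1 : (1 : ℝ) ≤ 2 ^ t := one_le_pow₀ (by norm_num)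
  have hn : (2 : ℝ) ^ r = 4 * (2 ^ i) ^ 2 * 2 ^ t := by
    rw [hr, pow_add, mul_add, pow_add, pow_mul']; norm_num; ring
  have hm : (2 : ℕ) ^ (i + 1) = 2 ^ i + 2 ^ i := by rw [pow_succ]; ring
  let c : unitInterval := ⟨1 / 2 ^ t, by positivity, by
    rw [div_le_one (by positivity)]; exact ht1⟩
  have hc : (c : ℝ) = 1 / 2 ^ t := rfl
  refine ⟨cellRule (curveHyp r g),
    distinctCertifier (Set.range (curve r g)) (2 ^ i + 2 ^ i) c,
    isSoundCertifier_cellRule (curveHyp r g) (Set.range (curve r g)) (k := 2 * degreeBound r)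
      (by have := degreeBound_pos r; positivity) (fun h hh => ?_) (2 ^ i) c ?_ ?_, ?_⟩
  · obtain ⟨κ, E, hE, hx⟩ := exists_exceptions hg hh
    exact ⟨κ, E, by exact_mod_cast hE, hx⟩
  · rw [hc, mul_one_div, le_div_iff₀ (by positivity)]
    push_cast; exact h1
  · have h3 := degreeBound_le r
    rw [hn, le_div_iff₀ (by positivity)] at h3
    have hri : (i : ℝ) ≤ r + 1 := by rw [hr]; exact_mod_cast (by omega : i ≤ 2 * (i + 1) + t + 1)
    have h4 : (degreeBound r : ℝ) * (3072 * (2 ^ t) ^ 3) ≤ 4 * (2 ^ i) ^ 2 * 2 ^ t :=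
      (mul_le_mul_of_nonneg_left (h2.trans hri) (Nat.cast_nonneg _)).trans h3
    rw [hc, div_pow, one_pow, mul_one_div, le_div_iff₀ (by positivity)]
    push_cast
    refine le_of_mul_le_mul_right ?_ (by positivity : (0 : ℝ) < 4 * 2 ^ t)
    linarith
  · rw [hm]
    have hr0 : r ≠ 0 := by omega
    refine (expectedCertificate_le _ _ c (curveLaw r g) (by positivity)
      (curveLaw_singleton_le hr0 g) (curveLaw_range r g)).trans (le_of_eq ?_)
    rw [hc, hn]
    push_cast
    field_simp
    ring

end Benchmark

end SmartLearning

theorem theorem4p1 :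
    ∃ (X : Type) (_ : Countable X) (_ : MeasurableSpace X) (_ : DiscreteMeasurableSpace X)
      (H : Set (X → Bool)),
      ∀ (α β : ℝ), 0 < α → 0 < β →
        ∀ σ : ℕ → Set.Ioo (0 : ℝ) 1 → ℕ,
          (∀ η : Set.Ioo (0 : ℝ) 1,
            Asymptotics.IsBigO Filter.atTop (fun m : ℕ => (σ m η : ℝ))
              (fun m : ℕ => (m : ℝ) ^ (2 - β))) →
          ∀ A : SmartLearning.RandomizedLearner X,
            ¬ SmartLearning.IsRelativelySmart H α σ A := by
  refine ⟨SmartLearning.PlaneDomain, inferInstance, SmartLearning.PlaneDomain.measurableSpace,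
    inferInstance, SmartLearning.curveClass, fun α β hα hβ σ hσ A hA => ?_⟩
  -- With `η = 1 / 8` and `2 * 2 ^ (-t) * α < 1 / 8`, the bound for the smart learner is below the
  -- error `1 / 4` that it makes on some curve.
  let η : Set.Ioo (0 : ℝ) 1 := ⟨1 / 8, by norm_num, by norm_num⟩
  obtain ⟨t, ht⟩ := exists_pow_lt_of_lt_one (show (0 : ℝ) < 1 / (16 * α) by positivity)
    (show (1 / 2 : ℝ) < 1 by norm_num)
  have e1 := (Filter.tendsto_add_atTop_nat 1).eventually
    (SmartLearning.eventually_lt_degreeBound hβ t (fun m => σ m η) (hσ η))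
  have e2 := (tendsto_pow_atTop_atTop_of_one_lt (show (1 : ℝ) < 2 by norm_num)).eventually_ge_atTop
    (48 * 2 ^ t)
  have e3 := (tendsto_natCast_atTop_atTop (R := ℝ)).eventually_ge_atTop (3072 * (2 ^ t) ^ 3)
  obtain ⟨i, h1, h2, h3⟩ := (e1.and (e2.and e3)).exists
  obtain ⟨g, hg, hlow⟩ := SmartLearning.exists_le_errorRate A
    (r := 2 * (i + 1) + t) (by omega) h1
  obtain ⟨A', C, hC, hup⟩ := SmartLearning.exists_certified rfl h2 h3 hg
  have h4 := hA.errorRate_le hC (SmartLearning.curveLaw (2 * (i + 1) + t) g) (2 ^ (i + 1)) η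
  have h5 : α * SmartLearning.expectedCertificate C
      (SmartLearning.curveLaw (2 * (i + 1) + t) g) (2 ^ (i + 1)) ≤ α * (2 / 2 ^ t) :=
    mul_le_mul_of_nonneg_left hup hα.le
  have h6 : α * (2 / 2 ^ t) < 1 / 8 := by
    have h7 := mul_lt_mul_of_pos_left ht (show 0 < 2 * α by positivity)
    have h8 : 2 * α * (1 / (16 * α)) = 1 / 8 := by field_simp; norm_num
    have h9 : α * (2 / 2 ^ t) = 2 * α * (1 / 2) ^ t := by rw [div_pow, one_pow]; ring
    linarith
  have h10 : (η : ℝ) = 1 / 8 := rfl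
  have h11 := hlow.trans h4
  linarith
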